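/- Let $0<\alpha<1$ and $w(t)=(1+t)^{\alpha}$. For $n\ge 0$ let $\varphi_n=\sqrt{n+\tfrac12}\,P_n$, where $P_n$ is the Legendre polynomial of degree $n$, so that $\{\varphi_n\}_{n\ge0}$ is an orthonormal basis of $L^2(-1,1)$, and let $\psi_n=w\varphi_n$. For even $N\geq 2$ let $\mathbf{G}_N\in\mathbb{C}^{N\times N}$ be the Gram matrix, with respect to the inner product of $L^2(-1,1)$, of the $N$ functions $\varphi_0,\dots,\varphi_{N/2-1},\psi_0,\dots,\psi_{N/2-1}$, and let $\kappa(\mathbf{G}_N)=\|\mathbf{G}_N\|\,\|\mathbf{G}_N^{-1}\|$ be its condition number in the spectral norm. Then $\kappa(\mathbf{G}_N)\gtrsim 4^N$ as $N\to\infty$ up to an algebraic factor in $N$; that is, there exist $k\in\mathbb{N}$ and $c>0$, depending only on $\alpha$, such that $$\kappa(\mathbf{G}_N)\ \ge\ c\,N^{-k}\,4^{N}$$ for all sufficiently large even $N$. -/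

import Mathlib

open MeasureTheory Polynomial

noncomputable section

namespace LegendreFrame

/-- The `n`-th Legendre polynomial, by Rodrigues' formula
`P_n = (2^n n!)⁻¹ (d/dx)^n (x^2 - 1)^n`. -/
def legendreP (n : ℕ) : ℝ[X] :=
  C ((2 ^ n * (n.factorial : ℝ))⁻¹) * (derivative^[n] ((X ^ 2 - 1) ^ n))

/-- The `L²(-1,1)`-normalized Legendre polynomial of degree `n`, as a function. -/
def legendreFun (n : ℕ) (t : ℝ) : ℝ :=
  Real.sqrt ((n : ℝ) + 1 / 2) * (legendreP n).eval t

/-- The weight `w(t) = (1+t)^α`. -/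
def weight (α : ℝ) (t : ℝ) : ℝ := (1 + t) ^ α

/-- The functions `φ_n` (left summand) and `w φ_n` (right summand); `n` is the degree, `n ≥ 0`. -/
def systemFun (α : ℝ) : ℕ ⊕ ℕ → ℝ → ℂ
  | Sum.inl n => fun t => (legendreFun n t : ℂ)
  | Sum.inr n => fun t => ((weight α t * legendreFun n t : ℝ) : ℂ)

/-- Lebesgue measure on `(-1,1)`. -/
abbrev intervalMeasure : Measure ℝ := volume.restrict (Set.Ioo (-1 : ℝ) 1)

/-- The complex Hilbert space `L²(-1,1)`. -/
abbrev L2Interval : Type := Lp ℂ 2 intervalMeasure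

theorem continuous_legendreFun (n : ℕ) : Continuous (legendreFun n) :=
  continuous_const.mul (legendreP n).continuous

theorem continuous_systemFun {α : ℝ} (hα : 0 < α) (i : ℕ ⊕ ℕ) : Continuous (systemFun α i) := by
  cases i with
  | inl n => exact Complex.continuous_ofReal.comp (continuous_legendreFun n)
  | inr n =>
    refine Complex.continuous_ofReal.comp (Continuous.mul ?_ (continuous_legendreFun n))
    exact (continuous_const.add continuous_id).rpow_const fun _ => Or.inr hα.le

theorem memLp_systemFun {α : ℝ} (hα : 0 < α) (i : ℕ ⊕ ℕ) :
    MemLp (systemFun α i) 2 intervalMeasure := by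
  have hc := continuous_systemFun hα i
  obtain ⟨K, hK⟩ := (isCompact_Icc (a := (-1 : ℝ)) (b := 1)).exists_bound_of_continuousOn
    hc.continuousOn
  refine MemLp.of_bound hc.aestronglyMeasurable K ?_
  filter_upwards [ae_restrict_mem measurableSet_Ioo] with t ht
  exact hK t (Set.Ioo_subset_Icc_self ht)

/-- The system `Φ = {φ_n} ∪ {w φ_n}` in `L²(-1,1)`. -/
def system (α : ℝ) (hα : 0 < α) (i : ℕ ⊕ ℕ) : L2Interval :=
  (memLp_systemFun hα i).toLp (systemFun α i)

/-- The truncated system `Φ_N` (for even `N`): the elements `φ_n` and `w φ_n` with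
`0 ≤ n < N / 2`. -/
def truncatedSystem (α : ℝ) (hα : 0 < α) (N : ℕ) (i : Fin (N / 2) ⊕ Fin (N / 2)) : L2Interval :=
  system α hα (Sum.map Fin.val Fin.val i)

/-- The truncated Gram matrix `G_N`. -/
def gramMatrix (α : ℝ) (hα : 0 < α) (N : ℕ) :
    Matrix (Fin (N / 2) ⊕ Fin (N / 2)) (Fin (N / 2) ⊕ Fin (N / 2)) ℂ :=
  Matrix.gram ℂ (truncatedSystem α hα N)

/-- The condition number `‖A‖ ‖A⁻¹‖` in the spectral norm, i.e. the operator norm induced by the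
Euclidean norm. (It is `0` for a singular matrix, by the convention for `A⁻¹`, so a positive lower
bound on it contains the invertibility of `A`.) -/
def condNumber {ι : Type*} [Fintype ι] [DecidableEq ι] (A : Matrix ι ι ℂ) : ℝ :=
  ‖Matrix.toEuclideanCLM (𝕜 := ℂ) A‖ * ‖Matrix.toEuclideanCLM (𝕜 := ℂ) A⁻¹‖

end LegendreFrame

end

/-! The lower bound comes from one explicit, nearly dependent combination. Let `m + 1 = N / 2` and
`u = log ((1 + t) / 2) ≤ 0`. The divided difference of `s ↦ exp (s * u)` at the nodes `0, …, m, α,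
…, m + α` equals `p + w q` with polynomials `p`, `q` of degree at most `m` (`expDividedDiff_log`),
so it lies in the span of the truncated system.

It is small: for `u ≤ 0` it has constant sign and is monotone, hence bounded by its limit at `-∞`,
the nodal weight `W₀` of the node `0` (`abs_expDividedDiff_node_le`). Its coefficients are large:
`p` at `1` is a sum of weights of one sign, that of the node `k` at least `(m.choose k)² |W₀| / (m +
1)` in size, so `|p(1)| ≥ 4^m |W₀| / (m + 1)²` (`four_pow_mul_nodalWeight_le`), while `|p(1)|` is at
most `(m + 1) / √2` times the coefficient norm (`norm_eval_one_sq_le`).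

The ratio of squared norms bounds `‖G⁻¹‖` below by `16^m / (m + 1)^6`, once `G` is known to be
invertible; and `‖G‖ ≥ ‖φ₀‖²`. -/

namespace LegendreFrame

/-! ### Divided differences of exponentials: sign and monotonicity -/

section ExpDividedDiff

variable {ι : Type*} [DecidableEq ι]

/-- The divided difference of `s ↦ exp (s * u)` at the nodes `v i`, `i ∈ s`. -/
noncomputable def expDividedDiff (s : Finset ι) (v : ι → ℝ) (u : ℝ) : ℝ :=
  ∑ i ∈ s, Lagrange.nodalWeight s v i * Real.exp (v i * u)

theorem nodalWeight_insert_mul_sub {s : Finset ι} {v : ι → ℝ} {c i : ι} (hc : c ∉ s)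
    (hi : i ∈ s) (hne : v i ≠ v c) :
    Lagrange.nodalWeight (insert c s) v i * (v i - v c) = Lagrange.nodalWeight s v i := by
  have hci : c ≠ i := fun h => hc (h ▸ hi)
  have hsub : v i - v c ≠ 0 := sub_ne_zero.mpr hne
  rw [Lagrange.nodalWeight, Lagrange.nodalWeight, Finset.erase_insert_of_ne hci,
    Finset.prod_insert (fun h => hc (Finset.mem_of_mem_erase h))]
  field_simp

/-- At `u = 0` the exponential is constant in `s`, and the divided difference is the coefficient of
degree `s.card - 1` of the polynomial `1`. -/
theorem expDividedDiff_zero {s : Finset ι} {v : ι → ℝ} (hv : Set.InjOn v s)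
    (hs : 2 ≤ s.card) : expDividedDiff s v 0 = 0 := by
  have h := Lagrange.coeff_eq_sum hv (P := (1 : ℝ[X])) (by
    rw [degree_one]; exact_mod_cast (by omega : 0 < s.card))
  rw [coeff_one, if_neg (by omega)] at h
  refine Eq.trans ?_ h.symm
  refine Finset.sum_congr rfl fun i _ => ?_
  simp [Lagrange.nodalWeight, Finset.prod_inv_distrib]

/-- Differentiation brings down `v i - v c`, which kills the term of `c` and cancels the factor of
`c` in every other weight. -/
theorem hasDerivAt_exp_neg_mul_expDividedDiff {s : Finset ι} {v : ι → ℝ} {c : ι}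
    (hc : c ∉ s) (hv : Set.InjOn v (insert c s : Finset ι)) (u : ℝ) :
    HasDerivAt (fun u => Real.exp (-v c * u) * expDividedDiff (insert c s) v u)
      (Real.exp (-v c * u) * expDividedDiff s v u) u := by
  have hterm (b : ℝ) : HasDerivAt (fun u : ℝ => Real.exp (b * u)) (Real.exp (b * u) * b) u := by
    simpa using ((hasDerivAt_id u).const_mul b).exp
  have hsum := HasDerivAt.fun_sum (u := insert c s)
    fun i _ => (hterm (v i)).const_mul (Lagrange.nodalWeight (insert c s) v i)
  refine ((hterm (-v c)).mul hsum).congr_deriv ?_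
  have hs : expDividedDiff s v u = ∑ i ∈ insert c s,
      Lagrange.nodalWeight (insert c s) v i * (v i - v c) * Real.exp (v i * u) := by
    rw [Finset.sum_insert hc, sub_self, mul_zero, zero_mul, zero_add, expDividedDiff]
    refine Finset.sum_congr rfl fun i hi => ?_
    rw [nodalWeight_insert_mul_sub hc hi fun h => hc ?_]
    rwa [← hv (Finset.mem_insert_of_mem hi) (Finset.mem_insert_self c s) h]
  rw [hs, mul_assoc, ← mul_add, Finset.mul_sum, ← Finset.sum_add_distrib]
  exact congrArg _ (Finset.sum_congr rfl fun i _ => by ring)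

/-- Induction on the nodes: after multiplication by `exp (-v c * u)` the derivative has the sign
known for one node fewer, and the function vanishes at `u = 0`. -/
theorem expDividedDiff_sign (s : Finset ι) {v : ι → ℝ} (hv : Set.InjOn v s)
    {u : ℝ} (hu : u ≤ 0) : 0 ≤ (-1) ^ (s.card + 1) * expDividedDiff s v u := by
  induction s using Finset.induction_on generalizing u with
  | empty => simp [expDividedDiff]
  | insert c s hc ih =>
    -- Vanishing at `0` needs two nodes; with a single node the divided difference is a plain
    -- exponential.
    rcases s.eq_empty_or_nonempty with rfl | hs
    · simp [expDividedDiff, Lagrange.nodalWeight, Real.exp_nonneg]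
    have hvs : Set.InjOn v s := hv.mono (by simp)
    have hcard : (insert c s).card = s.card + 1 := Finset.card_insert_of_notMem hc
    have hd : ∀ y, HasDerivAt
        (fun u => (-1) ^ (s.card + 2) * (Real.exp (-v c * u) * expDividedDiff (insert c s) v u))
        ((-1) ^ (s.card + 2) * (Real.exp (-v c * y) * expDividedDiff s v y)) y :=
      fun y => (hasDerivAt_exp_neg_mul_expDividedDiff hc hv y).const_mul _
    have hanti := antitoneOn_of_deriv_nonpos (convex_Iic (0 : ℝ))
      (fun y _ => (hd y).continuousAt.continuousWithinAt)
      (fun y _ => (hd y).differentiableAt.differentiableWithinAt) (fun y hy => by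
        rw [interior_Iic] at hy
        have h1 := mul_nonneg (Real.exp_nonneg (-v c * y)) (ih hvs (le_of_lt hy))
        rw [(hd y).deriv]
        have h2 : (-1 : ℝ) ^ (s.card + 2) * (Real.exp (-v c * y) * expDividedDiff s v y) =
          -(Real.exp (-v c * y) * ((-1) ^ (s.card + 1) * expDividedDiff s v y)) := by ring
        linarith)
    have h := hanti hu (Set.mem_Iic.mpr le_rfl) hu
    have hcard2 : 2 ≤ (insert c s).card := by have := hs.card_pos; omega
    simp only [expDividedDiff_zero hv hcard2, mul_zero] at h
    rw [hcard]
    refine nonneg_of_mul_nonneg_right (a := Real.exp (-v c * u)) ?_ (Real.exp_pos _)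
    linarith

/-- As `v c = 0`, the derivative is the divided difference over `s`, of the opposite sign. So the
absolute value decreases on `u ≤ 0` from its limit at `-∞`, where only the term of `c` survives. -/
theorem abs_expDividedDiff_le {s : Finset ι} {v : ι → ℝ} {c : ι} (hc : c ∉ s)
    (hv : Set.InjOn v (insert c s : Finset ι)) (hvc : v c = 0)
    (hpos : ∀ i ∈ s, 0 < v i) {u : ℝ} (hu : u ≤ 0) :
    |expDividedDiff (insert c s) v u| ≤ |Lagrange.nodalWeight (insert c s) v c| := by
  have hvs : Set.InjOn v s := hv.mono (by simp)
  set ε : ℝ := (-1) ^ (s.card + 1 + 1) with hε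
  have hεabs : |ε| = 1 := by rw [hε, abs_pow]; simp
  have hd : ∀ y, HasDerivAt (fun u => ε * expDividedDiff (insert c s) v u)
      (ε * expDividedDiff s v y) y := fun y => by
    simpa [hvc] using (hasDerivAt_exp_neg_mul_expDividedDiff hc hv y).const_mul ε
  have hanti := antitoneOn_of_deriv_nonpos (convex_Iic (0 : ℝ))
    (fun y _ => (hd y).continuousAt.continuousWithinAt)
    (fun y _ => (hd y).differentiableAt.differentiableWithinAt) (fun y hy => by
      rw [interior_Iic] at hy
      have h1 := expDividedDiff_sign s hvs (le_of_lt hy)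
      rw [(hd y).deriv, hε, pow_succ]
      linarith)
  have hlim : Filter.Tendsto (fun u => ε * expDividedDiff (insert c s) v u) Filter.atBot
      (nhds (ε * Lagrange.nodalWeight (insert c s) v c)) := by
    suffices h : Filter.Tendsto (fun u => expDividedDiff (insert c s) v u) Filter.atBot
        (nhds (Lagrange.nodalWeight (insert c s) v c)) from h.const_mul ε
    simp only [expDividedDiff, Finset.sum_insert hc, hvc, zero_mul, Real.exp_zero, mul_one]
    have h0 : Filter.Tendsto (fun u : ℝ => ∑ i ∈ s,
        Lagrange.nodalWeight (insert c s) v i * Real.exp (v i * u)) Filter.atBot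
        (nhds (∑ i ∈ s, Lagrange.nodalWeight (insert c s) v i * 0)) :=
      tendsto_finsetSum _ fun i hi => (Real.tendsto_exp_atBot.comp
        (Filter.tendsto_id.const_mul_atBot (hpos i hi))).const_mul _
    simpa using h0.const_add (Lagrange.nodalWeight (insert c s) v c)
  have hle : ε * expDividedDiff (insert c s) v u ≤
      ε * Lagrange.nodalWeight (insert c s) v c :=
    ge_of_tendsto hlim ((Filter.eventually_le_atBot u).mono fun y hy =>
      hanti (hy.trans hu) hu hy)
  have h0 : 0 ≤ ε * expDividedDiff (insert c s) v u := by
    have := expDividedDiff_sign (insert c s) hv hu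
    rwa [Finset.card_insert_of_notMem hc] at this
  calc |expDividedDiff (insert c s) v u| = |ε * expDividedDiff (insert c s) v u| := by
        rw [abs_mul, hεabs, one_mul]
    _ ≤ |ε * Lagrange.nodalWeight (insert c s) v c| := abs_le_abs_of_nonneg h0 hle
    _ = _ := by rw [abs_mul, hεabs, one_mul]

end ExpDividedDiff

/-! ### Nodal weights for the exponents `k` and `k + α` -/

section Nodes

/-- The exponents `k` (left summand) and `k + α` (right summand). -/
def node (α : ℝ) : ℕ ⊕ ℕ → ℝ := Sum.elim (fun k => (k : ℝ)) (fun k => (k : ℝ) + α)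

/-- The indices of the exponents `k` and `k + α` with `k < n`. -/
def nodeIndex (n : ℕ) : Finset (ℕ ⊕ ℕ) := (Finset.range n).disjSum (Finset.range n)

theorem node_injective {α : ℝ} (hα₀ : 0 < α) (hα₁ : α < 1) : Function.Injective (node α) := by
  have key : ∀ a b : ℕ, (a : ℝ) ≠ b + α := fun a b h => by
    have h1 : (b : ℝ) < a := by linarith
    have h2 : (a : ℝ) < b + 1 := by linarith
    norm_cast at h1 h2
    omega
  rintro (a | a) (b | b) h
  · simpa [node] using h
  · exact (key a b h).elim
  · exact (key b a h.symm).elim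
  · simpa [node] using h

theorem prod_range_erase {M : Type*} [CommMonoid M] (f : ℕ → M) (k r : ℕ) :
    ∏ j ∈ (Finset.range (k + 1 + r)).erase k, f j =
      (∏ j ∈ Finset.range k, f j) * ∏ i ∈ Finset.range r, f (k + 1 + i) := by
  induction r with
  | zero => simp [Finset.range_add_one]
  | succ r ih =>
    rw [← add_assoc, Finset.range_add_one, Finset.erase_insert_of_ne (by omega),
      Finset.prod_insert (by simp), ih, Finset.prod_range_succ, mul_comm, mul_assoc]

theorem prod_range_natCast_sub (k : ℕ) :
    ∏ j ∈ Finset.range k, ((k : ℝ) - j) = k.factorial := by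
  induction k with
  | zero => simp
  | succ k ih =>
    rw [Finset.prod_range_succ', Nat.factorial_succ]
    push_cast
    simp only [add_sub_add_right_eq_sub, ih]
    ring

/-- The product of the differences `(k - j) (k - j - α)`, `j < n`, `j ≠ k`. -/
noncomputable def nodeProd (α : ℝ) (n k : ℕ) : ℝ :=
  ∏ j ∈ (Finset.range n).erase k, ((k : ℝ) - j) * ((k : ℝ) - j - α)

theorem nodeProd_pos {α : ℝ} (hα₀ : 0 < α) (hα₁ : α < 1) (n k : ℕ) : 0 < nodeProd α n k := by
  refine Finset.prod_pos fun j hj => ?_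
  rcases lt_or_gt_of_ne (Finset.ne_of_mem_erase hj) with h | h
  · have h' : (j : ℝ) + 1 ≤ k := by exact_mod_cast h
    exact mul_pos (by linarith) (by linarith)
  · have h' : (k : ℝ) + 1 ≤ j := by exact_mod_cast h
    exact mul_pos_of_neg_of_neg (by linarith) (by linarith)

/-- With `d = |k - j|`, the factors are at most `d²` for `j < k` and `d (d + 1)` for `j > k`. -/
theorem nodeProd_le {α : ℝ} (hα₀ : 0 < α) (hα₁ : α < 1) (k r : ℕ) :
    nodeProd α (k + 1 + r) k ≤ ((k.factorial : ℝ) * r.factorial) ^ 2 * (r + 1) := by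
  have h1 : ∏ j ∈ Finset.range k, ((k : ℝ) - j) * ((k : ℝ) - j - α) ≤ (k.factorial : ℝ) ^ 2 := by
    rw [← prod_range_natCast_sub, ← Finset.prod_pow]
    refine Finset.prod_le_prod (fun j hj => ?_) (fun j hj => ?_)
    all_goals
      have h' : (j : ℝ) + 1 ≤ k := by exact_mod_cast Finset.mem_range.mp hj
      nlinarith
  have h2 : ∏ i ∈ Finset.range r, ((k : ℝ) - (k + 1 + i : ℕ)) * ((k : ℝ) - (k + 1 + i : ℕ) - α) ≤
      (r.factorial : ℝ) * (r + 1).factorial := by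
    have h3 : ∏ i ∈ Finset.range r, ((i : ℝ) + 1) * ((i : ℝ) + 1 + 1) =
        (r.factorial : ℝ) * (r + 1).factorial := by
      induction r with
      | zero => simp
      | succ r ih =>
        rw [Finset.prod_range_succ, ih, Nat.factorial_succ (r + 1), Nat.factorial_succ r]
        push_cast
        ring
    rw [← h3]
    refine Finset.prod_le_prod (fun i _ => ?_) (fun i _ => ?_)
    all_goals
      have h' : (0 : ℝ) ≤ i := by positivity
      push_cast
      nlinarith
  have h0 : 0 ≤ ∏ i ∈ Finset.range r,
      ((k : ℝ) - (k + 1 + i : ℕ)) * ((k : ℝ) - (k + 1 + i : ℕ) - α) :=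
    Finset.prod_nonneg fun i _ => by
      have h' : (0 : ℝ) ≤ i := by positivity
      push_cast
      nlinarith
  rw [nodeProd, prod_range_erase]
  refine (mul_le_mul h1 h2 h0 (by positivity)).trans_eq ?_
  rw [Nat.factorial_succ]
  push_cast
  ring

theorem factorial_sq_le_nodeProd {α : ℝ} (hα₀ : 0 < α) (m : ℕ) :
    (m.factorial : ℝ) ^ 2 ≤ nodeProd α (m + 1) 0 := by
  have h := prod_range_erase (fun j : ℕ => (((0 : ℕ) : ℝ) - j) * (((0 : ℕ) : ℝ) - j - α)) 0 m
  rw [nodeProd, show m + 1 = 0 + 1 + m by ring, h, Finset.prod_range_zero, one_mul]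
  rw [← Finset.prod_range_add_one_eq_factorial, Nat.cast_prod, ← Finset.prod_pow]
  refine Finset.prod_le_prod (fun i _ => by positivity) (fun i _ => ?_)
  have h' : (0 : ℝ) ≤ i := by positivity
  push_cast
  nlinarith

/-- The node `k + α` contributes `-1 / α`; all other nodes pair up into `nodeProd`, which is
positive. Hence these weights share one sign and cannot cancel in a sum. -/
theorem nodalWeight_inl {α : ℝ} {n k : ℕ} (hk : k < n) :
    Lagrange.nodalWeight (nodeIndex n) (node α) (Sum.inl k) = -(α * nodeProd α n k)⁻¹ := by
  have he : (nodeIndex n).erase (Sum.inl k) =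
      ((Finset.range n).erase k).disjSum (Finset.range n) := by
    ext (j | j) <;> simp [nodeIndex]
  rw [Lagrange.nodalWeight, he, Finset.prod_disjSum,
    ← Finset.mul_prod_erase (Finset.range n) _ (Finset.mem_range.mpr hk), mul_left_comm,
    ← Finset.prod_mul_distrib, nodeProd, mul_inv, ← Finset.prod_inv_distrib, ← neg_mul]
  congr 1
  · simp [node, inv_neg]
  · refine Finset.prod_congr rfl fun j _ => ?_
    simp [node, mul_comm, sub_sub]

theorem choose_sq_mul_nodalWeight_le {α : ℝ} (hα₀ : 0 < α) (hα₁ : α < 1) {m k : ℕ}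
    (hk : k ≤ m) :
    (m.choose k : ℝ) ^ 2 / (m + 1) *
        |Lagrange.nodalWeight (nodeIndex (m + 1)) (node α) (Sum.inl 0)| ≤
      -Lagrange.nodalWeight (nodeIndex (m + 1)) (node α) (Sum.inl k) := by
  rw [nodalWeight_inl (by omega), nodalWeight_inl (by omega), abs_neg, neg_neg,
    abs_of_pos (inv_pos.mpr (mul_pos hα₀ (nodeProd_pos hα₀ hα₁ _ _)))]
  obtain ⟨r, rfl⟩ := Nat.exists_eq_add_of_le hk
  have h1 := nodeProd_le hα₀ hα₁ k r
  have h0 := factorial_sq_le_nodeProd hα₀ (k + r)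
  have hp := nodeProd_pos hα₀ hα₁ (k + 1 + r) k
  have hp0 := nodeProd_pos hα₀ hα₁ (k + r + 1) 0
  rw [show k + 1 + r = k + r + 1 by ring] at h1 hp
  have hc : ((k + r).factorial : ℝ) =
      (k + r).choose k * ((k.factorial : ℝ) * r.factorial) := by
    have := Nat.choose_mul_factorial_mul_factorial (Nat.le_add_right k r)
    rw [Nat.add_sub_cancel_left] at this
    rw [← mul_assoc]
    exact_mod_cast this.symm
  set C : ℝ := ((k + r).choose k : ℝ)
  set F : ℝ := (k.factorial : ℝ) * r.factorial
  set A := nodeProd α (k + r + 1) k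
  set B := nodeProd α (k + r + 1) 0
  have hC : 0 ≤ C := by positivity
  rw [div_mul_eq_mul_div, div_le_iff₀ (by positivity), ← div_eq_mul_inv,
    inv_mul_eq_div, div_le_div_iff₀ (by positivity) (by positivity)]
  have hr : (r : ℝ) + 1 ≤ ((k + r : ℕ) : ℝ) + 1 := by push_cast; linarith [k.cast_nonneg (α := ℝ)]
  have h2 : C ^ 2 * A ≤ (((k + r : ℕ) : ℝ) + 1) * B :=
    calc C ^ 2 * A ≤ C ^ 2 * (F ^ 2 * (r + 1)) := by gcongr
      _ = (r + 1) * (C * F) ^ 2 := by ring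
      _ ≤ (((k + r : ℕ) : ℝ) + 1) * B := by
        rw [← hc]; gcongr
  nlinarith

theorem four_pow_mul_nodalWeight_le {α : ℝ} (hα₀ : 0 < α) (hα₁ : α < 1) (m : ℕ) :
    (4 : ℝ) ^ m / (m + 1) ^ 2 *
        |Lagrange.nodalWeight (nodeIndex (m + 1)) (node α) (Sum.inl 0)| ≤
      |∑ k ∈ Finset.range (m + 1),
        Lagrange.nodalWeight (nodeIndex (m + 1)) (node α) (Sum.inl k)| := by
  -- Cauchy–Schwarz applied to `∑ (m.choose k) = 2 ^ m`.
  have h1 : (4 : ℝ) ^ m ≤ (m + 1) * ∑ k ∈ Finset.range (m + 1), (m.choose k : ℝ) ^ 2 := by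
    have h := sq_sum_le_card_mul_sum_sq (s := Finset.range (m + 1)) (f := fun k => (m.choose k : ℝ))
    rw [← Nat.cast_sum, Nat.sum_range_choose, Finset.card_range] at h
    push_cast at h
    rwa [← pow_mul, mul_comm m 2, pow_mul, show (2 : ℝ) ^ 2 = 4 by norm_num] at h
  rw [← abs_neg (∑ k ∈ Finset.range (m + 1), _), ← Finset.sum_neg_distrib]
  refine le_trans ?_ (le_abs_self _)
  refine le_trans ?_ (Finset.sum_le_sum fun k hk =>
    choose_sq_mul_nodalWeight_le hα₀ hα₁ (Nat.lt_succ_iff.mp (Finset.mem_range.mp hk)))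
  rw [← Finset.sum_mul, ← Finset.sum_div]
  refine mul_le_mul_of_nonneg_right ?_ (abs_nonneg _)
  rw [div_le_div_iff₀ (by positivity) (by positivity)]
  nlinarith [(by positivity : (0 : ℝ) < m + 1)]

theorem abs_expDividedDiff_node_le {α : ℝ} (hα₀ : 0 < α) (hα₁ : α < 1) {n : ℕ} (hn : 0 < n)
    {u : ℝ} (hu : u ≤ 0) :
    |expDividedDiff (nodeIndex n) (node α) u| ≤
      |Lagrange.nodalWeight (nodeIndex n) (node α) (Sum.inl 0)| := by
  have h0 : (Sum.inl 0 : ℕ ⊕ ℕ) ∈ nodeIndex n := by simpa [nodeIndex] using hn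
  have h := abs_expDividedDiff_le (s := (nodeIndex n).erase (Sum.inl 0)) (v := node α)
    (c := Sum.inl 0) (by simp) (node_injective hα₀ hα₁).injOn (by simp [node]) (by
      rintro (i | i) hi
      · simp only [Finset.mem_erase] at hi
        have : i ≠ 0 := by rintro rfl; exact hi.1 rfl
        simpa [node] using Nat.pos_of_ne_zero this
      · simp only [node, Sum.elim_inr]; positivity) hu
  rwa [Finset.insert_erase h0] at h

end Nodes

/-! ### Legendre polynomials: value at `1`, degree, expansions -/

section Legendre

/-- In `(x - 1)^n (x + 1)^n` the `n`-th Taylor coefficient at `1` is `(1 + 1)^n`. -/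
theorem eval_one_legendreP (n : ℕ) : (legendreP n).eval 1 = 1 := by
  have h1 : (X ^ 2 - 1 : ℝ[X]) = (X - C 1) * (X + C 1) := by rw [C_1]; ring
  have h2 : (hasseDeriv n ((X ^ 2 - 1 : ℝ[X]) ^ n)).eval 1 = 2 ^ n := by
    rw [← taylor_coeff, h1, mul_pow, taylor_mul, taylor_pow, taylor_pow, map_sub, map_add,
      taylor_X, taylor_C, add_sub_cancel_right, mul_comm, coeff_mul_X_pow',
      if_pos le_rfl, Nat.sub_self, coeff_zero_eq_eval_zero]
    norm_num
  rw [legendreP, eval_mul, eval_C, ← factorial_smul_hasseDeriv, LinearMap.smul_apply, eval_smul,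
    h2, nsmul_eq_mul]
  have := n.factorial_ne_zero
  field_simp

theorem degree_legendreP (n : ℕ) : (legendreP n).degree = n := by
  have hc : (2 ^ n * (n.factorial : ℝ))⁻¹ ≠ 0 := by positivity
  have hd : ((X ^ 2 - 1 : ℝ[X]) ^ n).degree = ((2 * n : ℕ) : WithBot ℕ) := by
    have h1 : (X ^ 2 - 1 : ℝ[X]).degree = 2 := by
      rw [← C_1]; exact degree_X_pow_sub_C (by norm_num) 1
    rw [degree_pow, h1]
    simp [mul_comm]
  rw [legendreP, degree_C_mul hc]
  have hn : ((X ^ 2 - 1 : ℝ[X]) ^ n).natDegree = 2 * n := natDegree_eq_of_degree_eq_some hd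
  refine le_antisymm ?_ ?_
  · refine degree_le_of_natDegree_le ((natDegree_iterate_derivative _ n).trans ?_)
    omega
  · refine le_degree_of_ne_zero ?_
    rw [coeff_iterate_derivative, ← two_mul, ← hn, coeff_natDegree, nsmul_eq_mul]
    refine mul_ne_zero ?_ ?_
    · rw [hn]
      exact_mod_cast (Nat.descFactorial_pos.mpr (by omega)).ne'
    · rw [leadingCoeff_ne_zero]
      intro h
      rw [h, degree_zero] at hd
      exact WithBot.natCast_ne_bot _ hd.symm

/-- The normalized Legendre polynomials, with complex coefficients. -/
noncomputable def legendreSeq : Polynomial.Sequence ℂ where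
  elems' n := C (Real.sqrt ((n : ℝ) + 1 / 2) : ℂ) * (legendreP n).map Complex.ofRealHom
  degree_eq' n := by
    rw [degree_C_mul, degree_map, degree_legendreP]
    exact_mod_cast (Real.sqrt_pos.mpr (by positivity)).ne'

theorem eval_legendreSeq (n : ℕ) (t : ℝ) : (legendreSeq n).eval (t : ℂ) = legendreFun n t := by
  change (C _ * _).eval _ = _
  rw [eval_mul, eval_C, legendreFun, Complex.ofReal_mul]
  congr 1
  exact eval_map_apply (Complex.ofRealHom) t

theorem norm_eval_one_legendreSeq_sq (n : ℕ) : ‖(legendreSeq n).eval 1‖ ^ 2 = n + 1 / 2 := by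
  have h := eval_legendreSeq n 1
  rw [Complex.ofReal_one] at h
  rw [h, legendreFun, eval_one_legendreP, mul_one, Complex.norm_real, Real.norm_eq_abs, sq_abs,
    Real.sq_sqrt (by positivity)]

theorem exists_sum_legendreSeq {n : ℕ} {p : ℂ[X]} (hp : p.degree < n) :
    ∃ z : Fin n → ℂ, p = ∑ i, z i • legendreSeq i := by
  have h := legendreSeq.span_degreeLT (m := n)
    fun i _ => (leadingCoeff_ne_zero.mpr (legendreSeq.ne_zero i)).isUnit
  have hp' : p ∈ Submodule.span ℂ (legendreSeq '' Set.Iio n) := by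
    rw [h]; exact mem_degreeLT.mpr hp
  have hr : legendreSeq '' Set.Iio n = Set.range (fun i : Fin n => legendreSeq i) := by
    ext q
    simp only [Set.mem_image, Set.mem_Iio, Set.mem_range]
    exact ⟨fun ⟨i, hi, hq⟩ => ⟨⟨i, hi⟩, hq⟩, fun ⟨i, hq⟩ => ⟨i, i.2, hq⟩⟩
  rw [hr, Submodule.mem_span_range_iff_exists_fun] at hp'
  obtain ⟨z, hz⟩ := hp'
  exact ⟨z, hz.symm⟩

theorem norm_eval_one_sq_le {n : ℕ} (z : Fin n → ℂ) :
    ‖(∑ i, z i • legendreSeq i).eval 1‖ ^ 2 ≤ (∑ i, ‖z i‖ ^ 2) * (n ^ 2 / 2) := by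
  have hsum : ∑ i : Fin n, ‖(legendreSeq i).eval 1‖ ^ 2 = (n : ℝ) ^ 2 / 2 := by
    simp only [norm_eval_one_legendreSeq_sq]
    rw [Fin.sum_univ_eq_sum_range (fun i => (i : ℝ) + 1 / 2)]
    induction n with
    | zero => simp
    | succ n ih =>
      rw [Finset.sum_range_succ, ih (fun i => z i.castSucc)]
      push_cast
      ring
  rw [eval_finsetSum, ← hsum]
  calc ‖∑ i, (z i • legendreSeq i).eval 1‖ ^ 2
      ≤ (∑ i, ‖z i‖ * ‖(legendreSeq i).eval 1‖) ^ 2 := by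
        gcongr
        refine (norm_sum_le _ _).trans_eq (Finset.sum_congr rfl fun i _ => ?_)
        rw [eval_smul, smul_eq_mul, norm_mul]
    _ ≤ _ := Finset.sum_mul_sq_le_sq_mul_sq _ _ _

end Legendre

/-! ### Independence of `1` and `x ^ α` over the polynomials -/

section Independence

theorem coeff_zero_eq_zero_of_add_rpow_mul_eq_zero {p q : ℂ[X]} {β : ℝ} (hβ : 0 < β)
    (h : ∀ x ∈ Set.Ioo (0 : ℝ) 1, p.eval (x : ℂ) + ((x ^ β : ℝ) : ℂ) * q.eval (x : ℂ) = 0) :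
    p.coeff 0 = 0 := by
  have hc : Continuous fun x : ℝ =>
      p.eval (x : ℂ) + ((x ^ β : ℝ) : ℂ) * q.eval (x : ℂ) :=
    (p.continuous.comp Complex.continuous_ofReal).add
      ((Complex.continuous_ofReal.comp (Real.continuous_rpow_const hβ.le)).mul
        (q.continuous.comp Complex.continuous_ofReal))
  have h0 : (0 : ℝ) ∈ closure (Set.Ioo (0 : ℝ) 1) := by
    rw [closure_Ioo (by norm_num)]; simp
  have h1 := Set.EqOn.closure (f := fun x : ℝ =>
      p.eval (x : ℂ) + ((x ^ β : ℝ) : ℂ) * q.eval (x : ℂ)) (g := fun _ => 0) h hc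
      continuous_const h0
  simpa [Real.zero_rpow hβ.ne', coeff_zero_eq_eval_zero] using h1

/-- Letting `x → 0` gives `X ∣ p`. Division by `x ^ α` then leaves a relation of the same form with
exponent `1 - α > 0` and the roles exchanged, so `X ∣ q`. Dividing both by `X` restores the original
relation. -/
theorem X_pow_dvd_of_add_rpow_mul_eq_zero {α : ℝ} (hα₀ : 0 < α) (hα₁ : α < 1) (k : ℕ)
    {p q : ℂ[X]}
    (h : ∀ x ∈ Set.Ioo (0 : ℝ) 1, p.eval (x : ℂ) + ((x ^ α : ℝ) : ℂ) * q.eval (x : ℂ) = 0) :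
    X ^ k ∣ p ∧ X ^ k ∣ q := by
  induction k generalizing p q with
  | zero => simp
  | succ k ih =>
    obtain ⟨p, rfl⟩ := X_dvd_iff.mpr (coeff_zero_eq_zero_of_add_rpow_mul_eq_zero hα₀ h)
    have hmul : ∀ {x : ℝ}, 0 < x → x ^ α * x ^ (1 - α) = x := fun hx => by
      rw [← Real.rpow_add hx, add_sub_cancel, Real.rpow_one]
    have hq : ∀ x ∈ Set.Ioo (0 : ℝ) 1,
        q.eval (x : ℂ) + ((x ^ (1 - α) : ℝ) : ℂ) * p.eval (x : ℂ) = 0 := fun x hx => by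
      have hx' := h x hx
      have hne : ((x ^ α : ℝ) : ℂ) ≠ 0 := by exact_mod_cast (Real.rpow_pos_of_pos hx.1 α).ne'
      refine (mul_eq_zero.mp ?_).resolve_left hne
      rw [← hx', eval_mul, eval_X, mul_add, ← mul_assoc, ← Complex.ofReal_mul, hmul hx.1]
      ring
    obtain ⟨q, rfl⟩ := X_dvd_iff.mpr (coeff_zero_eq_zero_of_add_rpow_mul_eq_zero (sub_pos.mpr hα₁) hq)
    have := ih (p := p) (q := q) fun x hx => by
      have hx' := h x hx
      have hne : (x : ℂ) ≠ 0 := by exact_mod_cast hx.1.ne'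
      refine (mul_eq_zero.mp ?_).resolve_left hne
      rw [← hx', eval_mul, eval_mul, eval_X]
      ring
    rw [pow_succ']
    exact ⟨mul_dvd_mul_left X this.1, mul_dvd_mul_left X this.2⟩

theorem eq_zero_of_add_rpow_mul_eq_zero {α : ℝ} (hα₀ : 0 < α) (hα₁ : α < 1) {p q : ℂ[X]}
    (h : ∀ x ∈ Set.Ioo (0 : ℝ) 1, p.eval (x : ℂ) + ((x ^ α : ℝ) : ℂ) * q.eval (x : ℂ) = 0) :
    p = 0 ∧ q = 0 := by
  constructor
  · ext k
    exact X_pow_dvd_iff.mp (X_pow_dvd_of_add_rpow_mul_eq_zero hα₀ hα₁ (k + 1) h).1 k k.lt_succ_self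
  · ext k
    exact X_pow_dvd_iff.mp (X_pow_dvd_of_add_rpow_mul_eq_zero hα₀ hα₁ (k + 1) h).2 k k.lt_succ_self

end Independence

/-! ### Norm bounds for Gram matrices and their inverses -/

section Gram

variable {ι E : Type*} [Fintype ι] [DecidableEq ι] [NormedAddCommGroup E] [InnerProductSpace ℂ E]

theorem inner_toEuclideanCLM_gram (v : ι → E) (x y : EuclideanSpace ℂ ι) :
    inner ℂ x (Matrix.toEuclideanCLM (𝕜 := ℂ) (Matrix.gram ℂ v) y) =
      inner ℂ (∑ i, x i • v i) (∑ i, y i • v i) := by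
  rw [← Matrix.star_dotProduct_gram_mulVec, EuclideanSpace.inner_eq_star_dotProduct,
    Matrix.ofLp_toEuclideanCLM, dotProduct_comm]

theorem norm_sq_le_norm_gram (v : ι → E) (i : ι) :
    ‖v i‖ ^ 2 ≤ ‖Matrix.toEuclideanCLM (𝕜 := ℂ) (Matrix.gram ℂ v)‖ := by
  have h := inner_toEuclideanCLM_gram v (EuclideanSpace.single i 1) (EuclideanSpace.single i 1)
  have hs : ∑ j, (EuclideanSpace.single i (1 : ℂ)) j • v j = v i := by
    simp
  rw [hs, inner_self_eq_norm_sq_to_K] at h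
  have h2 := norm_inner_le_norm (𝕜 := ℂ) (EuclideanSpace.single i (1 : ℂ))
    (Matrix.toEuclideanCLM (𝕜 := ℂ) (Matrix.gram ℂ v) (EuclideanSpace.single i 1))
  have h3 := (Matrix.toEuclideanCLM (𝕜 := ℂ) (Matrix.gram ℂ v)).le_opNorm
    (EuclideanSpace.single i 1)
  rw [h] at h2
  simp at h2 h3
  linarith

/-- Put `y = G⁻¹ z`, and write `T` for synthesis. Then `‖z‖² = ⟪T z, T y⟫` and `‖T y‖² = ⟪y, z⟫ ≤
‖G⁻¹‖ ‖z‖²`; Cauchy–Schwarz combines the two. -/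
theorem norm_sq_le_norm_sum_sq_mul_norm_gram_inv {v : ι → E} (hv : LinearIndependent ℂ v)
    (z : EuclideanSpace ℂ ι) :
    ‖z‖ ^ 2 ≤ ‖∑ i, z i • v i‖ ^ 2 *
      ‖Matrix.toEuclideanCLM (𝕜 := ℂ) (Matrix.gram ℂ v)⁻¹‖ := by
  set G := Matrix.gram ℂ v
  set y := Matrix.toEuclideanCLM (𝕜 := ℂ) G⁻¹ z with hy
  have hGy : Matrix.toEuclideanCLM (𝕜 := ℂ) G y = z := by
    have hdet : IsUnit G.det :=
      isUnit_iff_ne_zero.mpr (Matrix.det_gram_ne_zero_iff_linearIndependent.mpr hv)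
    rw [hy, ← mul_apply_eq_comp, ← map_mul, Matrix.mul_nonsing_inv G hdet, map_one,
      one_apply_eq_self]
  have h1 : ‖z‖ ^ 2 ≤ ‖∑ i, z i • v i‖ * ‖∑ i, y i • v i‖ := by
    have h := inner_toEuclideanCLM_gram v z y
    rw [hGy, inner_self_eq_norm_sq_to_K] at h
    have h2 := norm_inner_le_norm (𝕜 := ℂ) (∑ i, z i • v i) (∑ i, y i • v i)
    rw [← h] at h2
    simpa using h2
  have h2 : ‖∑ i, y i • v i‖ ^ 2 ≤ ‖Matrix.toEuclideanCLM (𝕜 := ℂ) G⁻¹‖ * ‖z‖ ^ 2 := by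
    have h := inner_toEuclideanCLM_gram v y y
    rw [hGy, inner_self_eq_norm_sq_to_K] at h
    have h2 := norm_inner_le_norm (𝕜 := ℂ) y z
    have h3 := (Matrix.toEuclideanCLM (𝕜 := ℂ) G⁻¹).le_opNorm z
    rw [h] at h2
    have h4 : ‖∑ i, y i • v i‖ ^ 2 ≤ ‖y‖ * ‖z‖ := by simpa using h2
    calc _ ≤ _ := h4
      _ ≤ (‖Matrix.toEuclideanCLM (𝕜 := ℂ) G⁻¹‖ * ‖z‖) * ‖z‖ := by gcongr
      _ = _ := by ring
  rcases (norm_nonneg z).eq_or_lt with hz | hz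
  · rw [← hz, zero_pow two_ne_zero]; positivity
  have h3 : (‖z‖ ^ 2) ^ 2 ≤ (‖∑ i, z i • v i‖ ^ 2 *
      ‖Matrix.toEuclideanCLM (𝕜 := ℂ) G⁻¹‖) * ‖z‖ ^ 2 :=
    calc (‖z‖ ^ 2) ^ 2 ≤ (‖∑ i, z i • v i‖ * ‖∑ i, y i • v i‖) ^ 2 := by gcongr
      _ = ‖∑ i, z i • v i‖ ^ 2 * ‖∑ i, y i • v i‖ ^ 2 := by ring
      _ ≤ ‖∑ i, z i • v i‖ ^ 2 * (‖Matrix.toEuclideanCLM (𝕜 := ℂ) G⁻¹‖ * ‖z‖ ^ 2) := by gcongr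
      _ = _ := by ring
  rw [sq (‖z‖ ^ 2)] at h3
  exact le_of_mul_le_mul_right h3 (by positivity)

end Gram

/-! ### The near-dependent combination and the final bound -/

section Main

theorem coeFn_sum_smul_truncatedSystem {α : ℝ} (hα : 0 < α) (N : ℕ)
    (c : Fin (N / 2) ⊕ Fin (N / 2) → ℂ) :
    (∑ i, c i • truncatedSystem α hα N i : L2Interval) =ᵐ[intervalMeasure] fun t =>
      (∑ i, c (Sum.inl i) • legendreSeq i).eval (t : ℂ) +
        (weight α t : ℂ) * (∑ i, c (Sum.inr i) • legendreSeq i).eval (t : ℂ) := by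
  have h1 : ∀ i, (c i • truncatedSystem α hα N i : L2Interval) =ᵐ[intervalMeasure]
      fun t => c i * systemFun α (Sum.map Fin.val Fin.val i) t := fun i => by
    filter_upwards [Lp.coeFn_smul (c i) (truncatedSystem α hα N i),
      (memLp_systemFun hα (Sum.map Fin.val Fin.val i)).coeFn_toLp] with t ht1 ht2
    rw [ht1, Pi.smul_apply, smul_eq_mul, truncatedSystem, system, ht2]
  filter_upwards [Lp.coeFn_finsetSum Finset.univ fun i => c i • truncatedSystem α hα N i,
    Filter.eventually_all.mpr h1] with t ht1 ht2
  rw [ht1, Finset.sum_apply, Finset.sum_congr rfl fun i _ => ht2 i, Fintype.sum_sum_type,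
    eval_finsetSum, eval_finsetSum, Finset.mul_sum]
  congr 1 <;> refine Finset.sum_congr rfl fun i _ => ?_
  · simp [systemFun, eval_legendreSeq]
  · simp [systemFun, eval_legendreSeq]
    ring

theorem linearIndependent_truncatedSystem {α : ℝ} (hα₀ : 0 < α) (hα₁ : α < 1) (N : ℕ) :
    LinearIndependent ℂ (truncatedSystem α hα₀ N) := by
  rw [Fintype.linearIndependent_iff]
  intro c hc
  set p : ℂ[X] := ∑ i, c (Sum.inl i) • legendreSeq i with hp
  set q : ℂ[X] := ∑ i, c (Sum.inr i) • legendreSeq i with hq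
  have hae : (fun t : ℝ => p.eval (t : ℂ) + (weight α t : ℂ) * q.eval (t : ℂ))
      =ᵐ[intervalMeasure] fun _ => 0 := by
    have h := coeFn_sum_smul_truncatedSystem hα₀ N c
    rw [hc] at h
    exact h.symm.trans (Lp.coeFn_zero ℂ 2 intervalMeasure)
  have hcont : Continuous fun t : ℝ =>
      p.eval (t : ℂ) + (weight α t : ℂ) * q.eval (t : ℂ) :=
    (p.continuous.comp Complex.continuous_ofReal).add
      ((Complex.continuous_ofReal.comp
        ((continuous_const.add continuous_id).rpow_const fun _ => Or.inr hα₀.le)).mul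
        (q.continuous.comp Complex.continuous_ofReal))
  have heq := Measure.eqOn_Ioo_of_ae_eq volume hae hcont.continuousOn continuousOn_const
  -- The shift `x = 1 + t` turns the weight into `x ^ α`.
  have h0 := eq_zero_of_add_rpow_mul_eq_zero hα₀ hα₁ (p := taylor (-1) p) (q := taylor (-1) q)
    fun x hx => by
      have h := heq (show x - 1 ∈ Set.Ioo (-1 : ℝ) 1 from
        ⟨by linarith [hx.1], by linarith [hx.2]⟩)
      simpa [weight, taylor_eval, sub_eq_add_neg] using h
  rw [taylor_eq_zero, taylor_eq_zero] at h0
  have hli : LinearIndependent ℂ fun i : Fin (N / 2) => legendreSeq i :=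
    legendreSeq.linearIndependent.comp _ Fin.val_injective
  rw [Fintype.linearIndependent_iff] at hli
  rintro (i | i)
  · exact hli _ h0.1 i
  · exact hli _ h0.2 i

theorem norm_sq_le_of_ae_bound {f : L2Interval} {K : ℝ} (hK : 0 ≤ K)
    (h : ∀ᵐ t ∂intervalMeasure, ‖f t‖ ≤ K) : ‖f‖ ^ 2 ≤ 2 * K ^ 2 := by
  have h1 := Lp.norm_le_of_ae_bound hK h
  have h2 : ((measureUnivNNReal intervalMeasure : NNReal) : ℝ) = 2 := by
    rw [measureUnivNNReal, ← ENNReal.toReal, Measure.restrict_apply_univ, Real.volume_Ioo]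
    norm_num
  rw [h2, ENNReal.toReal_ofNat, ← one_div, ← Real.sqrt_eq_rpow] at h1
  calc ‖f‖ ^ 2 ≤ (Real.sqrt 2 * K) ^ 2 := by gcongr
    _ = _ := by rw [mul_pow, Real.sq_sqrt (by norm_num)]

/-- The polynomial `∑ a_k ((1 + X) / 2) ^ k` over `k < n`. -/
noncomputable def halfShiftPoly (a : ℕ → ℝ) (n : ℕ) : ℂ[X] :=
  ∑ k ∈ Finset.range n, C (a k : ℂ) * (C (1 / 2) * X + C (1 / 2)) ^ k

theorem degree_halfShiftPoly_lt (a : ℕ → ℝ) (n : ℕ) : (halfShiftPoly a n).degree < n := by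
  rw [← mem_degreeLT]
  refine Submodule.sum_mem _ fun k hk => mem_degreeLT.mpr ?_
  refine lt_of_le_of_lt (b := (k : WithBot ℕ)) ?_ (by exact_mod_cast Finset.mem_range.mp hk)
  rw [← smul_eq_C_mul]
  refine (degree_smul_le _ _).trans ((degree_pow_le _ k).trans ?_)
  simp

theorem eval_halfShiftPoly (a : ℕ → ℝ) (n : ℕ) (t : ℝ) :
    (halfShiftPoly a n).eval (t : ℂ) =
      ((∑ k ∈ Finset.range n, a k * ((1 + t) / 2) ^ k : ℝ) : ℂ) := by
  rw [halfShiftPoly, eval_finsetSum, Complex.ofReal_sum]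
  refine Finset.sum_congr rfl fun k _ => ?_
  simp
  left
  ring

/-- With `x = (1 + t) / 2`, the exponentials become `x ^ k` and `x ^ (k + α) = 2 ^ (-α) w(t) x ^ k`.
-/
theorem expDividedDiff_log {α t : ℝ} (ht : -1 < t) (n : ℕ) :
    expDividedDiff (nodeIndex n) (node α) (Real.log ((1 + t) / 2)) =
      (∑ k ∈ Finset.range n,
        Lagrange.nodalWeight (nodeIndex n) (node α) (Sum.inl k) * ((1 + t) / 2) ^ k) +
      weight α t * ∑ k ∈ Finset.range n,
        (2 ^ (-α) * Lagrange.nodalWeight (nodeIndex n) (node α) (Sum.inr k)) *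
          ((1 + t) / 2) ^ k := by
  have hx : 0 < (1 + t) / 2 := by linarith
  have hw : weight α t * 2 ^ (-α) = ((1 + t) / 2) ^ α := by
    rw [weight, Real.div_rpow (by linarith) (by norm_num), Real.rpow_neg (by norm_num),
      div_eq_mul_inv]
  rw [expDividedDiff]
  nth_rewrite 1 [nodeIndex]
  rw [Finset.sum_disjSum, Finset.mul_sum]
  congr 1 <;> refine Finset.sum_congr rfl fun k _ => ?_
  · rw [mul_comm (node α _), ← Real.rpow_def_of_pos hx]
    simp [node]
  · rw [mul_comm (node α _), ← Real.rpow_def_of_pos hx, node, Sum.elim_inr, Real.rpow_add hx,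
      Real.rpow_natCast, ← hw]
    ring

theorem sixteen_pow_div_le_norm_gram_inv {α : ℝ} (hα₀ : 0 < α) (hα₁ : α < 1) {m N : ℕ}
    (hN : N / 2 = m + 1) :
    (16 : ℝ) ^ m / (m + 1) ^ 6 ≤
      ‖Matrix.toEuclideanCLM (𝕜 := ℂ) (gramMatrix α hα₀ N)⁻¹‖ := by
  set W := Lagrange.nodalWeight (nodeIndex (m + 1)) (node α) with hW
  set p := halfShiftPoly (fun k => W (Sum.inl k)) (m + 1) with hp
  set q := halfShiftPoly (fun k => 2 ^ (-α) * W (Sum.inr k)) (m + 1) with hq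
  obtain ⟨z₁, hz₁⟩ := exists_sum_legendreSeq (n := N / 2) (p := p)
    (by rw [hN]; exact degree_halfShiftPoly_lt _ _)
  obtain ⟨z₂, hz₂⟩ := exists_sum_legendreSeq (n := N / 2) (p := q)
    (by rw [hN]; exact degree_halfShiftPoly_lt _ _)
  set z : EuclideanSpace ℂ (Fin (N / 2) ⊕ Fin (N / 2)) := WithLp.toLp 2 (Sum.elim z₁ z₂) with hz
  set I := ‖Matrix.toEuclideanCLM (𝕜 := ℂ) (gramMatrix α hα₀ N)⁻¹‖
  have hgram : ‖z‖ ^ 2 ≤ ‖∑ i, z i • truncatedSystem α hα₀ N i‖ ^ 2 * I :=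
    norm_sq_le_norm_sum_sq_mul_norm_gram_inv (linearIndependent_truncatedSystem hα₀ hα₁ N) z
  have hF : ‖∑ i, z i • truncatedSystem α hα₀ N i‖ ^ 2 ≤ 2 * |W (Sum.inl 0)| ^ 2 := by
    refine norm_sq_le_of_ae_bound (abs_nonneg _) ?_
    filter_upwards [coeFn_sum_smul_truncatedSystem hα₀ N z,
      ae_restrict_mem measurableSet_Ioo] with t ht ht'
    have hzl : ∑ i, z (Sum.inl i) • legendreSeq i = p := hz₁.symm
    have hzr : ∑ i, z (Sum.inr i) • legendreSeq i = q := hz₂.symm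
    rw [ht, hzl, hzr, hp, hq, eval_halfShiftPoly, eval_halfShiftPoly, ← Complex.ofReal_mul,
      ← Complex.ofReal_add, ← expDividedDiff_log ht'.1, Complex.norm_real, Real.norm_eq_abs]
    exact abs_expDividedDiff_node_le hα₀ hα₁ m.succ_pos
      (Real.log_nonpos (by linarith [ht'.1]) (by linarith [ht'.2]))
  have hp1 : (16 : ℝ) ^ m / (m + 1) ^ 4 * |W (Sum.inl 0)| ^ 2 ≤ ‖p.eval 1‖ ^ 2 := by
    have h := eval_halfShiftPoly (fun k => W (Sum.inl k)) (m + 1) 1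
    rw [Complex.ofReal_one] at h
    have hs : ((1 : ℝ) + 1) / 2 = 1 := by norm_num
    simp only [hs, one_pow, mul_one] at h
    rw [hp, h, Complex.norm_real, Real.norm_eq_abs]
    calc (16 : ℝ) ^ m / (m + 1) ^ 4 * |W (Sum.inl 0)| ^ 2
        = ((4 : ℝ) ^ m / (m + 1) ^ 2 * |W (Sum.inl 0)|) ^ 2 := by
          rw [mul_pow, div_pow, ← pow_mul, ← pow_mul, mul_comm m 2, pow_mul]
          norm_num
      _ ≤ _ := by
          gcongr
          exact four_pow_mul_nodalWeight_le hα₀ hα₁ m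
  have hpz : ‖p.eval 1‖ ^ 2 ≤ ‖z‖ ^ 2 * ((m + 1) ^ 2 / 2) := by
    have h := norm_eval_one_sq_le z₁
    have hcast : ((N / 2 : ℕ) : ℝ) = m + 1 := by rw [hN]; push_cast; rfl
    rw [← hz₁, hcast] at h
    refine h.trans ?_
    gcongr
    rw [EuclideanSpace.norm_sq_eq, Fintype.sum_sum_type]
    exact le_add_of_nonneg_right (by positivity)
  have hW0 : 0 < |W (Sum.inl 0)| ^ 2 := by
    have h : W (Sum.inl 0) ≠ 0 := Lagrange.nodalWeight_ne_zero
      (node_injective hα₀ hα₁).injOn (by simp [nodeIndex])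
    positivity
  have hI : 0 ≤ I := norm_nonneg _
  refine le_of_mul_le_mul_right ?_ hW0
  calc (16 : ℝ) ^ m / (m + 1) ^ 6 * |W (Sum.inl 0)| ^ 2
      = (16 : ℝ) ^ m / (m + 1) ^ 4 * |W (Sum.inl 0)| ^ 2 / (m + 1) ^ 2 := by
        field_simp
    -- The exponent `6` is `4` from the bound on `p(1)` plus `2` from evaluation at `1`; the `2` is
    -- the length of the interval.
    _ ≤ (2 * |W (Sum.inl 0)| ^ 2 * I * ((m + 1) ^ 2 / 2)) / (m + 1) ^ 2 := by
        refine div_le_div_of_nonneg_right (hp1.trans (hpz.trans ?_)) (by positivity)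
        refine mul_le_mul_of_nonneg_right ?_ (by positivity)
        exact hgram.trans (by gcongr)
    _ = I * |W (Sum.inl 0)| ^ 2 := by
        field_simp

end Main

end LegendreFrame

theorem proposition4 (α : ℝ) (hα₀ : 0 < α) (hα₁ : α < 1) :
    ∃ k : ℕ, ∃ c : ℝ, 0 < c ∧ ∀ᶠ N : ℕ in Filter.atTop, Even N →
      c * 4 ^ N / (N : ℝ) ^ k ≤
        LegendreFrame.condNumber (LegendreFrame.gramMatrix α hα₀ N) := by
  have hne : LegendreFrame.truncatedSystem α hα₀ 2 (Sum.inl ⟨0, by norm_num⟩) ≠ 0 :=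
    (LegendreFrame.linearIndependent_truncatedSystem hα₀ hα₁ 2).ne_zero _
  change LegendreFrame.system α hα₀ (Sum.inl 0) ≠ 0 at hne
  have hg : 0 < ‖LegendreFrame.system α hα₀ (Sum.inl 0)‖ ^ 2 := by positivity
  -- For `N = 2 (m + 1)`, `4 ^ N = 16 * 16 ^ m` and `N ^ 6 = 64 (m + 1) ^ 6`; the factor `4`
  -- compensates for `16 / 64`. The norm of `φ₀` does not depend on `N`.
  refine ⟨6, 4 * ‖LegendreFrame.system α hα₀ (Sum.inl 0)‖ ^ 2, by positivity, ?_⟩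
  filter_upwards [Filter.eventually_ge_atTop 2] with N hN hev
  obtain ⟨m, rfl⟩ : ∃ m, N = 2 * (m + 1) := by
    obtain ⟨r, rfl⟩ := hev
    exact ⟨r - 1, by omega⟩
  have hN2 : 2 * (m + 1) / 2 = m + 1 := by omega
  have h1 := LegendreFrame.sixteen_pow_div_le_norm_gram_inv hα₀ hα₁ hN2
  have h2 := LegendreFrame.norm_sq_le_norm_gram
    (LegendreFrame.truncatedSystem α hα₀ (2 * (m + 1))) (Sum.inl ⟨0, by omega⟩)
  calc 4 * ‖LegendreFrame.system α hα₀ (Sum.inl 0)‖ ^ 2 * 4 ^ (2 * (m + 1)) /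
        ((2 * (m + 1) : ℕ) : ℝ) ^ 6
      = ‖LegendreFrame.system α hα₀ (Sum.inl 0)‖ ^ 2 * ((16 : ℝ) ^ m / (m + 1) ^ 6) := by
        rw [pow_mul, pow_succ _ m]
        push_cast
        rw [mul_pow, show (4 : ℝ) ^ 2 = 16 by norm_num]
        field_simp
        norm_num
    _ ≤ _ := mul_le_mul h2 h1 (by positivity) (norm_nonneg _)
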